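/- Let $\mathcal D_\square=\{r\ge 0 : r^2=m^2+n^2 \text{ with } m,n\in\mathbb Z\}$ be the set of radii of the circular shells of the square lattice $\mathbb Z^2$. Let $\eta_\square(0)=1$ and, for $r\in\mathcal D_\square\setminus\{0\}$, let $\eta_\square(r)=4\,a(r^2)$, where $a(n)$ is the number of ideals of norm $n$ in the ring $\mathbb Z[i]$ of Gaussian integers. For $r\ge 0$ let $\mu_r$ be the uniform probability measure on the circle $\{x\in\mathbb R^2:|x|=r\}$ (so $\mu_0=\delta_0$), and let $J_0(z)=\sum_{\ell\ge 0}\frac{(-1)^\ell}{(\ell!)^2}\left(\frac z2\right)^{2\ell}$. The Fourier transform is normalised by the kernel $e^{-2\pi i k\cdot x}$ and, for measures, is taken in the space $\mathcal S'(\mathbb R^2)$ of tempered distributions. For all $r\ge 0$ and $k\in\mathbb R^2$, \[ \widehat{\mu}_r(k)=\int_{\mathbb R^2}e^{-2\pi i k\cdot x}\,d\mu_r(x)=J_0(2\pi|k|r), \] and the distributional Fourier transform of $\mu_r$ is the tempered distribution given by this function. Moreover, $\sum_{r\in\mathcal D_\square}\eta_\square(r)\,\mu_r$ is a tempered measure (it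 integrates $(1+|x|)^{-n}$ for some $n\in\mathbb N$), and \[ \sum_{r\in\mathcal D_\square}\eta_\square(r)\,\mu_r=\Bigl(\sum_{r\in\mathcal D_\square}\eta_\square(r)\,\mu_r\Bigr)^{\widehat{}}=\sum_{r\in\mathcal D_\square}\eta_\square(r)\,J_0(2\pi|k|r), \] where each function $k\mapsto J_0(2\pi|k|r)$ in the last series is regarded as a tempered distribution and the series converges unconditionally in $\mathcal S'(\mathbb R^2)$ with the topology of pointwise convergence on Schwartz functions. -/

import Mathlib

open MeasureTheory
open scoped ENNReal FourierTransform SchwartzMap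

/-- The Euclidean plane. -/
abbrev Plane : Type := EuclideanSpace ℝ (Fin 2)

/-- The radii of the non-empty circular shells of the square lattice. -/
def squareRadii : Set ℝ :=
  {r | 0 ≤ r ∧ ∃ m n : ℤ, r ^ 2 = (m : ℝ) ^ 2 + (n : ℝ) ^ 2}

/-- The number of ideals of norm `n` in the ring of Gaussian integers, for `n ≥ 1`. The norm of a
non-zero ideal is its index, the cardinality of the quotient ring. -/
noncomputable def gaussianIdealCount (n : ℕ) : ℕ :=
  {I : Ideal GaussianInt | Nat.card (GaussianInt ⧸ I) = n}.ncard

open Classical in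
/-- The shelling numbers of the square lattice. For a radius `r` in `squareRadii` the number `r ^ 2`
is a natural number, so that taking the integer part only changes its type. -/
noncomputable def shellingNumber (r : ℝ) : ℕ :=
  if r = 0 then 1 else 4 * gaussianIdealCount ⌊r ^ 2⌋₊

/-- The point of the plane with polar coordinates `(r, θ)`. -/
noncomputable def polarPoint (r θ : ℝ) : Plane :=
  !₂[r * Real.cos θ, r * Real.sin θ]

theorem measurable_polarPoint (r : ℝ) : Measurable (polarPoint r) := by
  have h : Continuous (polarPoint r) := by
    unfold polarPoint
    fun_prop
  exact h.measurable

/-- The uniform probability measure on the circle of radius `r` about the origin: the image of the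
normalised Lebesgue measure on `[0, 2π)` under `θ ↦ (r cos θ, r sin θ)`. -/
noncomputable def circleMeasure (r : ℝ) : Measure Plane :=
  ((ENNReal.ofReal (2 * Real.pi))⁻¹ •
    (volume.restrict (Set.Ico (0 : ℝ) (2 * Real.pi)))).map (polarPoint r)

instance instIsProbabilityMeasureCircleMeasure (r : ℝ) :
    IsProbabilityMeasure (circleMeasure r) := by
  have hpi : 0 < ENNReal.ofReal (2 * Real.pi) := by
    rw [ENNReal.ofReal_pos]
    positivity
  constructor
  rw [circleMeasure, Measure.map_apply (measurable_polarPoint r) MeasurableSet.univ]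
  simp only [Set.preimage_univ, Measure.smul_apply, Measure.restrict_apply_univ, Real.volume_Ico,
    sub_zero, smul_eq_mul]
  exact ENNReal.inv_mul_cancel hpi.ne' ENNReal.ofReal_ne_top

/-- At radius zero the uniform measure is the Dirac measure at the origin. -/
theorem circleMeasure_zero : circleMeasure 0 = Measure.dirac 0 := by
  have h : polarPoint 0 = fun _ => (0 : Plane) := by
    funext θ
    ext i
    fin_cases i <;> simp [polarPoint]
  have h1 := (instIsProbabilityMeasureCircleMeasure 0).measure_univ
  rw [circleMeasure, h, Measure.map_const] at h1 ⊢
  simp only [Measure.smul_apply, measure_univ, smul_eq_mul, mul_one] at h1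
  simp only [Measure.smul_apply, smul_eq_mul]
  rw [h1, one_smul]

/-- The measure `∑ r ∈ squareRadii, η(r) μ_r`, with `η` the shelling numbers and `μ_r` the uniform
probability measures on the circles. -/
noncomputable def radialSquareMeasure : Measure Plane :=
  Measure.sum fun r : squareRadii => (shellingNumber r : ℝ≥0∞) • circleMeasure r

/-- The Bessel function `J₀` of the first kind on the real line, by its power series. -/
noncomputable def besselJZero (z : ℝ) : ℝ :=
  ∑' l : ℕ, (-1 : ℝ) ^ l / ((l.factorial : ℝ) ^ 2) * (z / 2) ^ (2 * l)

/-- The power series of `J₀` converges everywhere. -/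
theorem summable_besselJZero (z : ℝ) :
    Summable fun l : ℕ => (-1 : ℝ) ^ l / ((l.factorial : ℝ) ^ 2) * (z / 2) ^ (2 * l) := by
  refine Summable.of_norm_bounded (Real.summable_pow_div_factorial ((z / 2) ^ 2)) fun l => ?_
  have hl : (1 : ℝ) ≤ (l.factorial : ℝ) := by exact_mod_cast l.factorial_pos
  rw [norm_mul, norm_div, norm_pow, norm_neg, norm_one, one_pow, pow_mul, Real.norm_eq_abs,
    Real.norm_eq_abs, abs_of_nonneg (by positivity), abs_of_nonneg (by positivity),
    div_mul_eq_mul_div, one_mul]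
  gcongr
  nlinarith

/-- The tempered distribution `T` is the one given by the function `f`, that is,
`T(φ) = ∫ φ(k) f(k) dk` for all Schwartz functions `φ`, with absolutely convergent integrals. -/
def IsGivenByFunction (T : 𝓢'(Plane, ℂ)) (f : Plane → ℂ) : Prop :=
  ∀ φ : 𝓢(Plane, ℂ), Integrable (fun k => φ k * f k) ∧ T φ = ∫ k, φ k * f k

/-! ### Shelling numbers count lattice points -/

namespace GaussianInt

/-- The Gaussian integers are additively the pairs of their coordinates. -/
def coordEquiv : GaussianInt ≃ₗ[ℤ] (Fin 2 → ℤ) where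
  toFun z := ![z.re, z.im]
  invFun v := ⟨v 0, v 1⟩
  map_add' x y := by ext i; fin_cases i <;> simp
  map_smul' c x := by ext i; fin_cases i <;> simp
  left_inv z := by simp
  right_inv v := by ext i; fin_cases i <;> simp

/-- The basis `1, i` of the Gaussian integers. -/
noncomputable def intBasis : Module.Basis (Fin 2) ℤ GaussianInt :=
  Module.Basis.ofEquivFun coordEquiv

instance instFreeInt : Module.Free ℤ GaussianInt := Module.Free.of_basis intBasis

instance instFiniteInt : Module.Finite ℤ GaussianInt := Module.Finite.of_basis intBasis

theorem algebra_norm_eq (z : GaussianInt) : Algebra.norm ℤ z = z.norm := by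
  have h0 : intBasis 0 = (⟨1, 0⟩ : GaussianInt) := by
    simp [intBasis, coordEquiv, Module.Basis.coe_ofEquivFun]
  have h1 : intBasis 1 = (⟨0, 1⟩ : GaussianInt) := by
    simp [intBasis, coordEquiv, Module.Basis.coe_ofEquivFun]
  have hr : ∀ w : GaussianInt, intBasis.repr w 0 = w.re := fun w => rfl
  have hi : ∀ w : GaussianInt, intBasis.repr w 1 = w.im := fun w => rfl
  rw [Algebra.norm_eq_matrix_det intBasis, Matrix.det_fin_two]
  simp only [Algebra.leftMulMatrix_eq_repr_mul, h0, h1, hr, hi, Zsqrtd.re_mul, Zsqrtd.im_mul,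
    Zsqrtd.norm_def]
  ring

theorem card_quotient_span_singleton (z : GaussianInt) :
    Nat.card (GaussianInt ⧸ Ideal.span {z}) = z.norm.natAbs := by
  rw [← algebra_norm_eq, ← Ideal.absNorm_span_singleton, Ideal.absNorm_apply,
    Submodule.cardQuot_apply]

theorem card_units : Nat.card GaussianIntˣ = 4 := by
  let S : Finset GaussianInt := {⟨1, 0⟩, ⟨-1, 0⟩, ⟨0, 1⟩, ⟨0, -1⟩}
  have hS : ∀ z : GaussianInt, z ∈ S ↔ IsUnit z := by
    intro z
    rw [← Zsqrtd.norm_eq_one_iff' (by norm_num), Zsqrtd.norm_def]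
    simp only [S, Finset.mem_insert, Finset.mem_singleton, Zsqrtd.ext_iff]
    constructor
    · rintro (⟨h, h'⟩ | ⟨h, h'⟩ | ⟨h, h'⟩ | ⟨h, h'⟩) <;> simp [h, h']
    · intro h
      have h1 : z.re ≤ 1 := by nlinarith [mul_self_nonneg z.im]
      have h2 : -1 ≤ z.re := by nlinarith [mul_self_nonneg z.im]
      have h3 : z.im ≤ 1 := by nlinarith [mul_self_nonneg z.re]
      have h4 : -1 ≤ z.im := by nlinarith [mul_self_nonneg z.re]
      generalize z.re = a at *
      generalize z.im = b at *
      interval_cases a <;> interval_cases b <;> simp_all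
  have e : GaussianIntˣ ≃ S :=
    { toFun := fun u => ⟨u, (hS _).2 u.isUnit⟩
      invFun := fun z => ((hS _).1 z.2).unit
      left_inv := fun u => by ext1; simp
      right_inv := fun z => by ext1; simp }
  rw [Nat.card_congr e, Nat.card_eq_fintype_card, Fintype.card_coe]
  rfl

/-- The elements of norm `n ≥ 1` are in fours the generators of the ideals of norm `n`. -/
theorem card_norm_eq {n : ℕ} (hn : n ≠ 0) :
    Nat.card {z : GaussianInt // z.norm = n} = 4 * gaussianIdealCount n := by
  have hgen : ∀ I : Ideal GaussianInt, Ideal.span {Submodule.IsPrincipal.generator I} = I :=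
    fun I => Submodule.IsPrincipal.span_singleton_generator I
  let e : GaussianIntˣ × {I : Ideal GaussianInt | Nat.card (GaussianInt ⧸ I) = n} →
      {z : GaussianInt // z.norm = n} := fun p =>
    ⟨Submodule.IsPrincipal.generator p.2.1 * p.1, by
      have h := p.2.2
      have h' := card_quotient_span_singleton (Submodule.IsPrincipal.generator p.2.1)
      rw [hgen] at h'
      rw [Zsqrtd.norm_mul, (Zsqrtd.norm_eq_one_iff' (by norm_num) _).2 p.1.isUnit, mul_one,
        ← abs_natCast_norm, ← h', h]⟩
  have hspan : ∀ p, Ideal.span {(e p).1} = p.2.1 := fun p => by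
    rw [← hgen p.2.1]
    exact Ideal.span_singleton_mul_right_unit p.1.isUnit _
  have he : Function.Bijective e := by
    constructor
    · intro p q hpq
      have h2 : p.2 = q.2 := Subtype.ext (by rw [← hspan p, ← hspan q, hpq])
      refine Prod.ext (Units.ext ?_) h2
      have h1 : Submodule.IsPrincipal.generator p.2.1 * (p.1 : GaussianInt) =
          Submodule.IsPrincipal.generator q.2.1 * q.1 := congrArg Subtype.val hpq
      rw [← h2] at h1
      refine mul_left_cancel₀ (fun h0 => ?_) h1
      have := (e p).2
      simp [e, h0] at this
      exact hn (by exact_mod_cast this.symm)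
    · rintro ⟨z, hz⟩
      have hI : Nat.card (GaussianInt ⧸ Ideal.span {z}) = n := by
        rw [card_quotient_span_singleton, hz, Int.natAbs_natCast]
      obtain ⟨u, hu⟩ := Ideal.span_singleton_eq_span_singleton.1 (hgen (Ideal.span {z}))
      exact ⟨(u, ⟨_, hI⟩), Subtype.ext hu⟩
  rw [← Nat.card_eq_of_bijective e he, Nat.card_prod, card_units, gaussianIdealCount,
    Nat.card_coe_set_eq]

end GaussianInt

/-- The points of the square lattice. -/
noncomputable def latticePoint (p : ℤ × ℤ) : Plane := !₂[(p.1 : ℝ), (p.2 : ℝ)]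

theorem norm_sq_latticePoint (p : ℤ × ℤ) :
    ‖latticePoint p‖ ^ 2 = (p.1 : ℝ) ^ 2 + (p.2 : ℝ) ^ 2 := by
  simp [latticePoint, EuclideanSpace.norm_sq_eq, Fin.sum_univ_two]

/-- The shell of a lattice point. -/
noncomputable def latticeShell (p : ℤ × ℤ) : squareRadii :=
  ⟨‖latticePoint p‖, norm_nonneg _, p.1, p.2, norm_sq_latticePoint p⟩

theorem card_latticeShell_fiber (r : squareRadii) :
    ENat.card {p : ℤ × ℤ // latticeShell p = r} = shellingNumber r := by
  obtain ⟨r, hr, m, n, hmn⟩ := r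
  have hmem : ∀ p : ℤ × ℤ, latticeShell p = ⟨r, hr, m, n, hmn⟩ ↔
      p.1 ^ 2 + p.2 ^ 2 = m ^ 2 + n ^ 2 := fun p => by
    rw [Subtype.ext_iff]
    change ‖latticePoint p‖ = r ↔ _
    rw [← sq_eq_sq₀ (norm_nonneg _) hr, norm_sq_latticePoint, hmn]
    exact_mod_cast Iff.rfl
  obtain ⟨N, hN⟩ : ∃ N : ℕ, m ^ 2 + n ^ 2 = (N : ℤ) := ⟨_, (Int.toNat_of_nonneg (by positivity)).symm⟩
  have hrN : r ^ 2 = N := by rw [hmn]; exact_mod_cast hN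
  let e : {p : ℤ × ℤ // latticeShell p = ⟨r, hr, m, n, hmn⟩} ≃
      {z : GaussianInt // z.norm = N} :=
    { toFun := fun p => ⟨⟨p.1.1, p.1.2⟩, by
        rw [Zsqrtd.norm_def, ← hN, ← (hmem _).1 p.2]; ring⟩
      invFun := fun z => ⟨(z.1.re, z.1.im), by
        rw [hmem, hN]; linarith [z.2, z.1.norm_def]⟩
      left_inv := fun p => rfl
      right_inv := fun z => rfl }
  rw [ENat.card_congr e]
  rcases eq_or_ne N 0 with rfl | hN0
  · have hr0 : r = 0 := by simpa using hrN
    have : Unique {z : GaussianInt // z.norm = (0 : ℕ)} :=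
      { default := ⟨0, by simp⟩
        uniq := fun z => Subtype.ext (GaussianInt.norm_eq_zero.1 (by simpa using z.2)) }
    simp [shellingNumber, hr0]
  · have hr0 : r ≠ 0 := fun h => hN0 (by simpa [h] using hrN.symm)
    have hfin : Finite {z : GaussianInt // z.norm = N} := by
      have hb : ∀ x y : ℤ, x ^ 2 + y ^ 2 = N → x ∈ Set.Icc (-N : ℤ) N := fun x y h => by
        rw [Set.mem_Icc, ← abs_le, ← Int.natCast_natAbs]
        have h1 : x.natAbs * x.natAbs ≤ N := by
          zify; rw [abs_mul_abs_self]; nlinarith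
        exact_mod_cast (Nat.le_mul_self _).trans h1
      refine Finite.of_injective (β := Set.Icc (-N : ℤ) N × Set.Icc (-N : ℤ) N)
        (fun z => (⟨z.1.re, hb _ z.1.im ?_⟩, ⟨z.1.im, hb _ z.1.re ?_⟩)) fun z w h => ?_
      · linarith [z.2, z.1.norm_def]
      · linarith [z.2, z.1.norm_def]
      · simp only [Prod.mk.injEq, Subtype.mk.injEq] at h
        exact Subtype.ext (Zsqrtd.ext h.1 h.2)
    rw [ENat.card_eq_coe_natCard, GaussianInt.card_norm_eq hN0, shellingNumber, if_neg hr0, hrN,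
      Nat.floor_natCast]

theorem radialSquareMeasure_eq_sum :
    radialSquareMeasure = Measure.sum fun p : ℤ × ℤ => circleMeasure ‖latticePoint p‖ := by
  ext s hs
  rw [radialSquareMeasure, Measure.sum_apply _ hs, Measure.sum_apply _ hs,
    ← (Equiv.sigmaFiberEquiv latticeShell).tsum_eq, ENNReal.tsum_sigma']
  refine tsum_congr fun r => ?_
  have h : ∀ p : {p // latticeShell p = r}, circleMeasure
      ‖latticePoint (Equiv.sigmaFiberEquiv latticeShell ⟨r, p⟩)‖ s = circleMeasure r s := by
    rintro ⟨p, rfl⟩; rfl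
  simp_rw [h]
  rw [ENNReal.tsum_const, card_latticeShell_fiber]
  simp

/-! ### Poisson summation in the plane -/

/-- The weight `1 / (1 + x²)`, used to express decay. -/
noncomputable def cauchyWeight (x : ℝ) : ℝ := (1 + x ^ 2)⁻¹

theorem cauchyWeight_pos (x : ℝ) : 0 < cauchyWeight x := by
  unfold cauchyWeight; positivity

theorem cauchyWeight_le_one (x : ℝ) : cauchyWeight x ≤ 1 :=
  inv_le_one_of_one_le₀ (by nlinarith [sq_nonneg x])

theorem cauchyWeight_sq_le (x : ℝ) : cauchyWeight x ^ 2 ≤ cauchyWeight x := by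
  have := cauchyWeight_pos x
  nlinarith [cauchyWeight_le_one x]

theorem cauchyWeight_isBigO :
    cauchyWeight =O[Filter.cocompact ℝ] fun x : ℝ => |x| ^ (-2 : ℝ) := by
  refine Asymptotics.IsBigO.of_bound 1 ?_
  filter_upwards [(isCompact_singleton (x := (0 : ℝ))).compl_mem_cocompact] with x (hx : x ≠ 0)
  have hx2 : 0 < x ^ 2 := by positivity
  rw [Real.norm_of_nonneg (cauchyWeight_pos x).le, Real.norm_of_nonneg (by positivity), one_mul,
    Real.rpow_neg (abs_nonneg x), Real.rpow_two, sq_abs, cauchyWeight]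
  gcongr
  linarith

theorem summable_cauchyWeight : Summable fun n : ℤ => cauchyWeight n :=
  summable_of_isBigO (Real.summable_abs_int_rpow one_lt_two)
    (cauchyWeight_isBigO.comp_tendsto Int.tendsto_coe_cofinite)

theorem integrable_cauchyWeight : Integrable cauchyWeight := integrable_inv_one_add_sq

theorem tsum_eq_tsum_fourier_of_norm_le_cauchyWeight {f : ℝ → ℂ} (hc : Continuous f) {C D : ℝ}
    (hf : ∀ x, ‖f x‖ ≤ C * cauchyWeight x) (hF : ∀ n : ℤ, ‖𝓕 f n‖ ≤ D * cauchyWeight n) :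
    ∑' n : ℤ, f n = ∑' n : ℤ, 𝓕 f n := by
  have h := Real.tsum_eq_tsum_fourier_of_rpow_decay_of_summable hc one_lt_two
    ((Asymptotics.IsBigO.of_bound C (Filter.Eventually.of_forall fun x => by
      rw [Real.norm_of_nonneg (cauchyWeight_pos x).le]; exact hf x)).trans cauchyWeight_isBigO)
    (Summable.of_norm_bounded (summable_cauchyWeight.mul_left D) hF) 0
  simpa using h

/-- Poisson summation over `ℤ × ℤ`, for a function `f` with decay whose Fourier transform `G`
(taken one variable after the other) also has decay. -/
theorem tsum_int_prod_eq_of_fourier_fourier {f G : ℝ → ℝ → ℂ} {C : ℝ} (hC : 0 ≤ C)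
    (hf : Continuous (Function.uncurry f)) (hG : Continuous (Function.uncurry G))
    (hfC : ∀ x y, ‖f x y‖ ≤ C * (cauchyWeight x ^ 2 * cauchyWeight y ^ 2))
    (hGC : ∀ x y, ‖G x y‖ ≤ C * (cauchyWeight x ^ 2 * cauchyWeight y ^ 2))
    (hfG : ∀ ξ η : ℝ, 𝓕 (fun x : ℝ => 𝓕 (f x) η) ξ = G ξ η) :
    ∑' p : ℤ × ℤ, f p.1 p.2 = ∑' p : ℤ × ℤ, G p.1 p.2 := by
  have hw := cauchyWeight_pos
  have hw1 := cauchyWeight_le_one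
  have hw2 := cauchyWeight_sq_le
  have hle : ∀ x y, C * (cauchyWeight x ^ 2 * cauchyWeight y ^ 2) ≤
      C * cauchyWeight x ^ 2 * cauchyWeight y := fun x y => by
    have := hw2 y
    have := hw x
    rw [← mul_assoc]; gcongr
  have hle' : ∀ x y, C * (cauchyWeight x ^ 2 * cauchyWeight y ^ 2) ≤
      C * cauchyWeight y ^ 2 * cauchyWeight x := fun x y => by
    rw [mul_comm (cauchyWeight x ^ 2)]; exact hle y x
  have hle1 : ∀ x y, C * (cauchyWeight x ^ 2 * cauchyWeight y ^ 2) ≤ C * cauchyWeight y :=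
    fun x y => (hle x y).trans (by
      have := pow_le_one₀ (n := 2) (hw x).le (hw1 x)
      have := hw y
      nlinarith [mul_nonneg hC (hw y).le])
  set I := ∫ x, cauchyWeight x with hI
  have hI0 : 0 ≤ I := integral_nonneg fun x => (hw x).le
  set h : ℝ → ℝ → ℂ := fun x η => 𝓕 (f x) η with hh
  have hfx : ∀ x, Continuous (f x) := fun x => hf.comp (Continuous.prodMk_right x)
  have hGy : ∀ y, Continuous fun x => G x y := fun y => hG.comp (Continuous.prodMk_left y)
  have hhx : ∀ x η, ‖h x η‖ ≤ C * I * cauchyWeight x ^ 2 := fun x η => by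
    rw [hh]
    refine (VectorFourier.norm_fourierIntegral_le_integral_norm _ _ _ _ _).trans ?_
    calc ∫ y, ‖f x y‖ ≤ ∫ y, C * cauchyWeight x ^ 2 * cauchyWeight y := by
          refine integral_mono_of_nonneg (Filter.Eventually.of_forall fun y => norm_nonneg _)
            (integrable_cauchyWeight.const_mul _)
            (Filter.Eventually.of_forall fun y => (hfC x y).trans (hle x y))
      _ = _ := by rw [integral_const_mul]; ring
  have hhx1 : ∀ x η, ‖h x η‖ ≤ C * I * cauchyWeight x := fun x η => (hhx x η).trans
    (mul_le_mul_of_nonneg_left (hw2 x) (by positivity))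
  have hcont : ∀ η, Continuous fun x => h x η := fun η => by
    simp only [hh, Real.fourier_real_eq]
    refine continuous_of_dominated (bound := fun y => C * cauchyWeight y) (fun x => ?_)
      (fun x => ?_) (integrable_cauchyWeight.const_mul C) ?_
    · refine Continuous.aestronglyMeasurable ?_
      have := hfx x
      fun_prop
    · refine Filter.Eventually.of_forall fun y => ?_
      rw [Circle.norm_smul]
      exact (hfC x y).trans (hle1 x y)
    · refine Filter.Eventually.of_forall fun y => ?_
      exact Continuous.const_smul (hf.comp (Continuous.prodMk_left y)) _
  have hint : ∀ η, Integrable fun x => h x η := fun η =>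
    (integrable_cauchyWeight.const_mul (C * I)).mono' (hcont η).aestronglyMeasurable
      (Filter.Eventually.of_forall fun x => hhx1 x η)
  have hFh : ∀ η, 𝓕 (fun x => h x η) = fun ξ => G ξ η := fun η => funext fun ξ => hfG ξ η
  have hGint : ∀ η, Integrable fun ξ => G ξ η := fun η =>
    (integrable_cauchyWeight.const_mul (C * cauchyWeight η ^ 2)).mono'
      (hGy η).aestronglyMeasurable
      (Filter.Eventually.of_forall fun x => (hGC x η).trans (hle' x η))
  have hhη : ∀ x η, ‖h x η‖ ≤ C * I * cauchyWeight η ^ 2 := fun x η => by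
    have hinv := (hcont η).fourierInv_fourier_eq (hint η) (by rw [hFh]; exact hGint η)
    rw [hFh] at hinv
    rw [← congrFun hinv x]
    refine (VectorFourier.norm_fourierIntegral_le_integral_norm _ _ _ _ _).trans ?_
    calc ∫ ξ, ‖G ξ η‖ ≤ ∫ ξ, C * cauchyWeight η ^ 2 * cauchyWeight ξ := by
          refine integral_mono_of_nonneg (Filter.Eventually.of_forall fun y => norm_nonneg _)
            (integrable_cauchyWeight.const_mul _)
            (Filter.Eventually.of_forall fun y => (hGC y η).trans (hle' y η))
      _ = _ := by rw [integral_const_mul]; ring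
  have hhη1 : ∀ x η, ‖h x η‖ ≤ C * I * cauchyWeight η := fun x η => (hhη x η).trans
    (mul_le_mul_of_nonneg_left (hw2 η) (by positivity))
  have hhmix : ∀ x η, ‖h x η‖ ≤ C * I * (cauchyWeight x * cauchyWeight η) := fun x η => by
    refine abs_le_of_sq_le_sq' ?_ (by have := hw x; have := hw η; positivity) |>.2
    calc ‖h x η‖ ^ 2 = ‖h x η‖ * ‖h x η‖ := sq _
      _ ≤ (C * I * cauchyWeight x ^ 2) * (C * I * cauchyWeight η ^ 2) :=
        mul_le_mul (hhx x η) (hhη x η) (norm_nonneg _) (by positivity)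
      _ = _ := by ring
  have hwsum : Summable fun p : ℤ × ℤ => cauchyWeight p.1 * cauchyWeight p.2 :=
    summable_cauchyWeight.mul_of_nonneg summable_cauchyWeight (fun n => (hw n).le)
      (fun n => (hw n).le)
  have hmix : ∀ x y, C * (cauchyWeight x ^ 2 * cauchyWeight y ^ 2) ≤
      C * (cauchyWeight x * cauchyWeight y) := fun x y => by
    have := hw x
    gcongr
    exacts [hw2 x, hw2 y]
  have hsum : ∀ (g : ℝ → ℝ → ℂ) (D : ℝ),
      (∀ x y, ‖g x y‖ ≤ D * (cauchyWeight x * cauchyWeight y)) →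
      Summable fun p : ℤ × ℤ => g p.1 p.2 := fun g D hg =>
    Summable.of_norm_bounded (hwsum.mul_left D) fun p => hg _ _
  have hfs := hsum f C fun x y => (hfC x y).trans (hmix x y)
  have hGs := hsum G C fun x y => (hGC x y).trans (hmix x y)
  have hhs := hsum h (C * I) hhmix
  calc ∑' p : ℤ × ℤ, f p.1 p.2 = ∑' (m : ℤ) (n : ℤ), f m n := hfs.tsum_prod
    _ = ∑' (m : ℤ) (n : ℤ), h m n := tsum_congr fun m =>
        tsum_eq_tsum_fourier_of_norm_le_cauchyWeight (hfx m)
          (fun y => (hfC m y).trans (hle1 m y)) fun n => hhη1 m n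
    _ = ∑' (n : ℤ) (m : ℤ), h m n := (Summable.tsum_comm (f := fun m n : ℤ => h m n) hhs).symm
    _ = ∑' (n : ℤ) (m : ℤ), G m n := tsum_congr fun n => by
        have h1 := tsum_eq_tsum_fourier_of_norm_le_cauchyWeight (hcont n)
          (fun x => hhx1 x n) (D := C * cauchyWeight n ^ 2)
          fun m => by rw [hFh]; exact (hGC m n).trans (hle' m n)
        rw [h1, hFh]
    _ = ∑' (m : ℤ) (n : ℤ), G m n := Summable.tsum_comm (f := fun m n : ℤ => G m n) hGs
    _ = ∑' p : ℤ × ℤ, G p.1 p.2 := hGs.tsum_prod.symm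

theorem norm_sq_plane (x y : ℝ) : ‖(!₂[x, y] : Plane)‖ ^ 2 = x ^ 2 + y ^ 2 := by
  simp [EuclideanSpace.norm_sq_eq, Fin.sum_univ_two]

theorem inv_one_add_norm_sq_pow_le (n : ℕ) (x y : ℝ) :
    ((1 + ‖(!₂[x, y] : Plane)‖) ^ (4 * n))⁻¹ ≤ cauchyWeight x ^ n * cauchyWeight y ^ n := by
  rw [← mul_pow, cauchyWeight, cauchyWeight, ← mul_inv, inv_pow, pow_mul]
  gcongr
  have h := norm_sq_plane x y
  have h0 := norm_nonneg (!₂[x, y] : Plane)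
  set t := ‖(!₂[x, y] : Plane)‖
  have h1 : 1 + x ^ 2 ≤ (1 + t) ^ 2 := by nlinarith [sq_nonneg y]
  have h2 : 1 + y ^ 2 ≤ (1 + t) ^ 2 := by nlinarith [sq_nonneg x]
  calc (1 + x ^ 2) * (1 + y ^ 2) ≤ (1 + t) ^ 2 * (1 + t) ^ 2 := by gcongr
    _ = _ := by ring

theorem SchwartzMap.exists_norm_le_cauchyWeight (φ : 𝓢(Plane, ℂ)) :
    ∃ C, 0 ≤ C ∧ (∀ v, ‖φ v‖ ≤ C * ((1 + ‖v‖) ^ 8)⁻¹) ∧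
      ∀ x y : ℝ, ‖φ !₂[x, y]‖ ≤ C * (cauchyWeight x ^ 2 * cauchyWeight y ^ 2) := by
  have h : ∀ v, ‖φ v‖ ≤ (2 ^ 8 * ((Finset.Iic (8, 0)).sup fun m =>
      SchwartzMap.seminorm ℝ m.1 m.2) φ) * ((1 + ‖v‖) ^ 8)⁻¹ := fun v => by
    have h1 := SchwartzMap.one_add_le_sup_seminorm_apply (𝕜 := ℝ) (m := (8, 0)) le_rfl le_rfl φ v
    rw [norm_iteratedFDeriv_zero] at h1
    rw [← div_eq_mul_inv, le_div_iff₀ (by positivity), mul_comm]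
    exact h1
  refine ⟨_, ?_, h, fun x y => (h _).trans ?_⟩
  · positivity
  · gcongr
    exact inv_one_add_norm_sq_pow_le 2 x y

theorem measurePreserving_plane :
    MeasurePreserving (fun p : ℝ × ℝ => (!₂[p.1, p.2] : Plane)) :=
  ((EuclideanSpace.volume_preserving_symm_measurableEquiv_toLp (Fin 2)).symm
    (MeasurableEquiv.toLp 2 (Fin 2 → ℝ)).symm).comp
    ((volume_preserving_finTwoArrow ℝ).symm MeasurableEquiv.finTwoArrow)

theorem measurableEmbedding_plane :
    MeasurableEmbedding (fun p : ℝ × ℝ => (!₂[p.1, p.2] : Plane)) :=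
  (MeasurableEquiv.toLp 2 (Fin 2 → ℝ)).measurableEmbedding.comp
    (MeasurableEquiv.finTwoArrow (α := ℝ)).symm.measurableEmbedding

theorem fourier_plane_eq_fourier_fourier (φ : 𝓢(Plane, ℂ)) (ξ η : ℝ) :
    𝓕 (fun x : ℝ => 𝓕 (fun y : ℝ => φ !₂[x, y]) η) ξ = 𝓕 φ !₂[ξ, η] := by
  have hint : Integrable fun v : Plane => 𝐞 (-inner ℝ v !₂[ξ, η]) • φ v :=
    (Real.fourierIntegral_convergent_iff _).2 φ.integrable
  rw [SchwartzMap.fourier_coe, Real.fourier_eq (φ : Plane → ℂ),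
    ← measurePreserving_plane.integral_comp measurableEmbedding_plane,
    Measure.volume_eq_prod, Real.fourier_real_eq]
  refine Eq.trans ?_ (integral_prod _
    ((measurePreserving_plane.integrable_comp_emb measurableEmbedding_plane).2 hint)).symm
  refine integral_congr_ae (Filter.Eventually.of_forall fun x => ?_)
  simp only [Real.fourier_real_eq, Circle.smul_def, smul_eq_mul, Function.comp_apply]
  rw [← integral_const_mul]
  refine integral_congr_ae (Filter.Eventually.of_forall fun y => ?_)
  simp only [← mul_assoc, ← Circle.coe_mul, ← AddChar.map_add_eq_mul]
  congr 3
  simp [PiLp.inner_apply, Fin.sum_univ_two]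
  ring

/-- Poisson summation for Schwartz functions on the plane. -/
theorem SchwartzMap.tsum_plane_eq_tsum_fourier (φ : 𝓢(Plane, ℂ)) :
    ∑' p : ℤ × ℤ, φ !₂[(p.1 : ℝ), (p.2 : ℝ)] = ∑' p : ℤ × ℤ, 𝓕 φ !₂[(p.1 : ℝ), (p.2 : ℝ)] := by
  obtain ⟨C, hC, -, hφ⟩ := φ.exists_norm_le_cauchyWeight
  obtain ⟨D, hD, -, hψ⟩ := (𝓕 φ).exists_norm_le_cauchyWeight
  have hcont : Continuous fun p : ℝ × ℝ => (!₂[p.1, p.2] : Plane) := by fun_prop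
  have hw := fun x : ℝ => cauchyWeight_pos x
  refine tsum_int_prod_eq_of_fourier_fourier (f := fun x y => φ !₂[x, y])
    (G := fun x y => 𝓕 φ !₂[x, y]) (C := C + D) (by positivity) (φ.continuous.comp hcont)
    ((𝓕 φ).continuous.comp hcont) (fun x y => (hφ x y).trans ?_) (fun x y => (hψ x y).trans ?_)
    (fourier_plane_eq_fourier_fourier φ)
  · gcongr; linarith
  · gcongr; linarith

/-! ### Integrals over circles -/

theorem norm_polarPoint {r : ℝ} (hr : 0 ≤ r) (θ : ℝ) : ‖polarPoint r θ‖ = r := by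
  rw [← sq_eq_sq₀ (norm_nonneg _) hr]
  simp only [polarPoint, EuclideanSpace.norm_sq_eq, Fin.sum_univ_two, Real.norm_eq_abs, sq_abs]
  simp only [Matrix.cons_val_zero, Matrix.cons_val_one]
  linear_combination r ^ 2 * Real.cos_sq_add_sin_sq θ

theorem exists_eq_polarPoint (v : Plane) : ∃ φ, v = polarPoint ‖v‖ φ := by
  refine ⟨Complex.arg ⟨v 0, v 1⟩, ?_⟩
  have hn : ‖v‖ = ‖(⟨v 0, v 1⟩ : ℂ)‖ := by
    rw [← sq_eq_sq₀ (norm_nonneg _) (norm_nonneg _), Complex.sq_norm, Complex.normSq_mk,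
      EuclideanSpace.norm_sq_eq, Fin.sum_univ_two, Real.norm_eq_abs, Real.norm_eq_abs, sq_abs,
      sq_abs]
    ring
  ext i
  rw [hn]
  fin_cases i
  · simp [polarPoint, Complex.norm_mul_cos_arg]
  · simp [polarPoint, Complex.norm_mul_sin_arg]

theorem polarPoint_periodic (r : ℝ) : Function.Periodic (polarPoint r) (2 * Real.pi) := fun θ => by
  simp [polarPoint]

theorem integral_circleMeasure (r : ℝ) {f : Plane → ℂ} (hf : Continuous f) :
    ∫ x, f x ∂circleMeasure r =
      (2 * Real.pi)⁻¹ • ∫ θ in (0 : ℝ)..2 * Real.pi, f (polarPoint r θ) := by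
  rw [circleMeasure, integral_map (measurable_polarPoint r).aemeasurable hf.aestronglyMeasurable,
    integral_smul_measure, intervalIntegral.integral_of_le (by positivity),
    integral_Ico_eq_integral_Ioc, ENNReal.toReal_inv, ENNReal.toReal_ofReal (by positivity)]

theorem integral_circleMeasure_shift (r φ : ℝ) {f : Plane → ℂ} (hf : Continuous f) :
    ∫ x, f x ∂circleMeasure r =
      (2 * Real.pi)⁻¹ • ∫ θ in (0 : ℝ)..2 * Real.pi, f (polarPoint r (θ + φ)) := by
  have hp : Function.Periodic (fun θ => f (polarPoint r θ)) (2 * Real.pi) := fun θ => by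
    simp only [polarPoint_periodic r θ]
  rw [integral_circleMeasure r hf,
    intervalIntegral.integral_comp_add_right (fun θ => f (polarPoint r θ)) φ, zero_add, add_comm,
    hp.intervalIntegral_add_eq φ 0, zero_add]

/-- The rotation of the plane by the angle `θ`. -/
noncomputable def planeRotation (θ : ℝ) : Plane ≃ₗᵢ[ℝ] Plane :=
  LinearIsometry.toLinearIsometryEquiv
    { toFun := fun v => !₂[Real.cos θ * v 0 - Real.sin θ * v 1, Real.sin θ * v 0 + Real.cos θ * v 1]
      map_add' := fun v w => by ext i; fin_cases i <;> simp <;> ring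
      map_smul' := fun c v => by ext i; fin_cases i <;> simp <;> ring
      norm_map' := fun v => by
        rw [← sq_eq_sq₀ (norm_nonneg _) (norm_nonneg _)]
        simp only [EuclideanSpace.norm_sq_eq, Fin.sum_univ_two, Real.norm_eq_abs, sq_abs,
          LinearMap.coe_mk, AddHom.coe_mk, Matrix.cons_val_zero, Matrix.cons_val_one]
        linear_combination (v 0 ^ 2 + v 1 ^ 2) * Real.cos_sq_add_sin_sq θ } rfl

theorem planeRotation_apply (θ : ℝ) (v : Plane) : planeRotation θ v =
    !₂[Real.cos θ * v 0 - Real.sin θ * v 1, Real.sin θ * v 0 + Real.cos θ * v 1] := rfl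

theorem planeRotation_polarPoint (θ r φ : ℝ) :
    planeRotation θ (polarPoint r φ) = polarPoint r (θ + φ) := by
  rw [planeRotation_apply]
  simp only [polarPoint, Real.cos_add, Real.sin_add]
  ext i
  fin_cases i <;> simp <;> ring

/-- The mean over a circle is the mean over the rotations of one of its points. -/
theorem integral_circleMeasure_norm (v : Plane) {f : Plane → ℂ} (hf : Continuous f) :
    ∫ x, f x ∂circleMeasure ‖v‖ =
      (2 * Real.pi)⁻¹ • ∫ θ in (0 : ℝ)..2 * Real.pi, f (planeRotation θ v) := by
  obtain ⟨φ, hφ⟩ := exists_eq_polarPoint v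
  rw [integral_circleMeasure_shift _ φ hf]
  congr 2
  ext θ
  rw [← planeRotation_polarPoint, ← hφ]

/-! ### The Bessel function as a mean over a circle -/

theorem integral_cos_pow_odd_period (l : ℕ) :
    ∫ θ in (0 : ℝ)..2 * Real.pi, Real.cos θ ^ (2 * l + 1) = 0 := by
  induction l with
  | zero => simp
  | succ l ih =>
    rw [show 2 * (l + 1) + 1 = (2 * l + 1) + 2 by ring, integral_cos_pow, ih]
    simp

theorem integral_cos_pow_even_period (l : ℕ) :
    ∫ θ in (0 : ℝ)..2 * Real.pi, Real.cos θ ^ (2 * l) =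
      2 * Real.pi * ((2 * l).factorial / (4 ^ l * (l.factorial : ℝ) ^ 2)) := by
  induction l with
  | zero => simp
  | succ l ih =>
    rw [show 2 * (l + 1) = 2 * l + 2 by ring, integral_cos_pow, ih, Nat.factorial_succ (2 * l + 1),
      Nat.factorial_succ (2 * l), Nat.factorial_succ l]
    have := l.factorial_ne_zero
    simp only [Real.sin_two_pi, Real.sin_zero]
    push_cast
    field_simp
    ring

theorem integral_exp_cos_eq_besselJZero (z : ℝ) :
    ∫ θ in (0 : ℝ)..2 * Real.pi, Complex.exp (-(z * Real.cos θ : ℝ) * Complex.I) =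
      2 * Real.pi * besselJZero z := by
  let a : ℕ → ℂ := fun n => (-z * Complex.I) ^ n / n.factorial
  have hterm : ∀ n, ∫ θ in (0 : ℝ)..2 * Real.pi, a n * ((Real.cos θ ^ n : ℝ) : ℂ) =
      a n * (∫ θ in (0 : ℝ)..2 * Real.pi, Real.cos θ ^ n : ℝ) := fun n => by
    rw [intervalIntegral.integral_const_mul, intervalIntegral.integral_ofReal]
  have h1 : HasSum (fun n => ∫ θ in (0 : ℝ)..2 * Real.pi, a n * ((Real.cos θ ^ n : ℝ) : ℂ))
      (∫ θ in (0 : ℝ)..2 * Real.pi, Complex.exp (-(z * Real.cos θ : ℝ) * Complex.I)) := by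
    refine intervalIntegral.hasSum_integral_of_dominated_convergence
      (fun n _ => |z| ^ n / n.factorial) (fun n => ?_) (fun n => ?_) ?_ ?_ ?_
    · exact Continuous.aestronglyMeasurable (by fun_prop)
    · refine Filter.Eventually.of_forall fun θ _ => ?_
      have hc : |Real.cos θ| ^ n ≤ 1 := pow_le_one₀ (abs_nonneg _) (Real.abs_cos_le_one θ)
      simp only [a, norm_mul, norm_div, norm_pow, norm_neg, Complex.norm_real, Complex.norm_I,
        mul_one, Complex.norm_natCast, Real.norm_eq_abs]
      exact mul_le_of_le_one_right (by positivity) hc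
    · exact Filter.Eventually.of_forall fun θ _ => Real.summable_pow_div_factorial |z|
    · exact intervalIntegrable_const
    · refine Filter.Eventually.of_forall fun θ _ => ?_
      have h := NormedSpace.expSeries_div_hasSum_exp (-(z * Real.cos θ : ℝ) * Complex.I)
      rw [← Complex.exp_eq_exp_ℂ] at h
      refine h.congr_fun fun n => ?_
      simp only [a]
      push_cast
      ring
  rw [funext hterm] at h1
  have hinj : Function.Injective fun l : ℕ => 2 * l := fun x y h => by simpa using h
  rw [← hinj.hasSum_iff] at h1
  · have h2 : HasSum (fun l : ℕ => 2 * (Real.pi : ℂ) *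
        ((-1 : ℝ) ^ l / ((l.factorial : ℝ) ^ 2) * (z / 2) ^ (2 * l) : ℝ))
        (2 * Real.pi * besselJZero z) :=
      (Complex.hasSum_ofReal.2 (summable_besselJZero z).hasSum).mul_left _
    refine h1.unique (h2.congr_fun fun l => ?_)
    have hl := l.factorial_ne_zero
    have hl2 := (2 * l).factorial_ne_zero
    have hI : (-z * Complex.I) ^ (2 * l) = (-1) ^ l * z ^ (2 * l) := by
      rw [pow_mul, mul_pow, Complex.I_sq, pow_mul, ← mul_pow]
      ring
    simp only [Function.comp_apply, a, integral_cos_pow_even_period, hI]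
    push_cast
    rw [div_pow, show (2 : ℂ) ^ (2 * l) = 4 ^ l by rw [pow_mul]; norm_num]
    field_simp
  · intro n hn
    obtain ⟨l, rfl⟩ : Odd n := by
      rw [← Nat.not_even_iff_odd]
      rintro ⟨l, rfl⟩
      exact hn ⟨l, by ring⟩
    rw [integral_cos_pow_odd_period, Complex.ofReal_zero, mul_zero]

theorem inner_polarPoint (r s θ φ : ℝ) :
    inner ℝ (polarPoint s φ) (polarPoint r θ) = s * r * Real.cos (θ - φ) := by
  simp [polarPoint, PiLp.inner_apply, Fin.sum_univ_two, Real.cos_sub]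
  ring

theorem integral_exp_inner_circleMeasure (r : ℝ) (k : Plane) :
    ∫ x, Complex.exp (-2 * Real.pi * Complex.I * (inner ℝ k x : ℝ)) ∂circleMeasure r =
      (besselJZero (2 * Real.pi * ‖k‖ * r) : ℂ) := by
  obtain ⟨φ, hφ⟩ := exists_eq_polarPoint k
  rw [integral_circleMeasure_shift r φ (by fun_prop)]
  have h : ∀ θ, Complex.exp (-2 * Real.pi * Complex.I *
      (inner ℝ k (polarPoint r (θ + φ)) : ℝ)) =
      Complex.exp (-((2 * Real.pi * ‖k‖ * r) * Real.cos θ : ℝ) * Complex.I) := fun θ => by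
    nth_rw 1 [hφ]
    rw [inner_polarPoint, add_sub_cancel_right]
    congr 1
    push_cast
    ring
  simp_rw [h]
  rw [integral_exp_cos_eq_besselJZero, Complex.real_smul]
  push_cast
  have := Real.pi_ne_zero
  field_simp

theorem fourierIntegral_circleMeasure (r : ℝ) (k : Plane) :
    VectorFourier.fourierIntegral 𝐞 (circleMeasure r) (innerₗ Plane) (fun _ => (1 : ℂ)) k =
      (besselJZero (2 * Real.pi * ‖k‖ * r) : ℂ) := by
  rw [← integral_exp_inner_circleMeasure, VectorFourier.fourierIntegral]
  refine integral_congr_ae (Filter.Eventually.of_forall fun x => ?_)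
  simp only [Circle.smul_def, Real.fourierChar_apply, innerₗ_apply_apply, smul_eq_mul, mul_one,
    real_inner_comm k x]
  congr 1
  push_cast
  ring

theorem isGivenByFunction_fourier_circleMeasure (r : ℝ) :
    IsGivenByFunction (𝓕 (circleMeasure r).toTemperedDistribution)
      (fun k => (besselJZero (2 * Real.pi * ‖k‖ * r) : ℂ)) := by
  intro φ
  simp_rw [← fourierIntegral_circleMeasure]
  have hL : Continuous fun p : Plane × Plane => innerₗ Plane p.1 p.2 := by
    simpa using continuous_inner
  have h1 : Integrable (fun _ : Plane => (1 : ℂ)) (circleMeasure r) := integrable_const _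
  have hc := VectorFourier.fourierIntegral_continuous Real.continuous_fourierChar hL h1
  constructor
  · refine φ.integrable.mul_bdd (c := 1) hc.aestronglyMeasurable
      (Filter.Eventually.of_forall fun k => ?_)
    exact (VectorFourier.norm_fourierIntegral_le_integral_norm _ _ _ _ _).trans (by simp)
  · rw [TemperedDistribution.fourier_apply, Measure.toTemperedDistribution_apply (circleMeasure r)]
    have h := VectorFourier.integral_fourierIntegral_smul_eq_flip Real.continuous_fourierChar hL
      h1 φ.integrable (ν := volume)
    simp only [smul_eq_mul, one_mul, flip_innerₗ] at h
    simp only [SchwartzMap.fourier_coe]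
    rw [show (fun k => φ k * _) = _ from funext fun k => mul_comm (φ k) _, h]
    rfl

/-! ### Self-duality of the radial lattice measure -/

theorem norm_ae_circleMeasure {r : ℝ} (hr : 0 ≤ r) : ∀ᵐ x ∂circleMeasure r, ‖x‖ = r := by
  rw [circleMeasure, ae_map_iff (measurable_polarPoint r).aemeasurable
    (measurableSet_eq_fun measurable_norm measurable_const)]
  exact Filter.Eventually.of_forall fun θ => norm_polarPoint hr θ

theorem summable_latticePoint (n : ℕ) :
    Summable fun p : ℤ × ℤ => ((1 + ‖latticePoint p‖) ^ (4 * (n + 1)))⁻¹ := by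
  have hw := fun n : ℤ => (cauchyWeight_pos n).le
  refine Summable.of_nonneg_of_le (fun p => by positivity) (fun p => ?_)
    (summable_cauchyWeight.mul_of_nonneg summable_cauchyWeight hw hw)
  refine (inv_one_add_norm_sq_pow_le (n + 1) _ _).trans ?_
  exact mul_le_mul (pow_le_of_le_one (hw _) (cauchyWeight_le_one _) n.succ_ne_zero)
    (pow_le_of_le_one (hw _) (cauchyWeight_le_one _) n.succ_ne_zero) (pow_nonneg (hw _) _) (hw _)

theorem hasTemperateGrowth_radialSquareMeasure : radialSquareMeasure.HasTemperateGrowth := by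
  refine ⟨4, ?_⟩
  have hc : Continuous fun x : Plane => ((1 + ‖x‖) ^ 4)⁻¹ :=
    Continuous.inv₀ (by fun_prop) fun x => by positivity
  have he : (fun x : Plane => (1 + ‖x‖) ^ (-((4 : ℕ) : ℝ))) = fun x => ((1 + ‖x‖) ^ 4)⁻¹ := by
    ext x
    rw [Real.rpow_neg (by positivity), Real.rpow_natCast]
  rw [he]
  refine ⟨hc.aestronglyMeasurable, ?_⟩
  rw [hasFiniteIntegral_iff_norm, radialSquareMeasure_eq_sum, lintegral_sum_measure]
  have h : ∀ p, ∫⁻ x, ENNReal.ofReal ‖((1 + ‖x‖) ^ 4)⁻¹‖ ∂circleMeasure ‖latticePoint p‖ =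
      ENNReal.ofReal ((1 + ‖latticePoint p‖) ^ 4)⁻¹ := fun p => by
    rw [lintegral_congr_ae (g := fun _ => ENNReal.ofReal ((1 + ‖latticePoint p‖) ^ 4)⁻¹),
      lintegral_const, measure_univ, mul_one]
    filter_upwards [norm_ae_circleMeasure (norm_nonneg (latticePoint p))] with x hx
    rw [hx, Real.norm_of_nonneg (by positivity)]
  simp_rw [h]
  rw [← ENNReal.ofReal_tsum_of_nonneg (fun p => by positivity) (summable_latticePoint 0)]
  exact ENNReal.ofReal_lt_top

theorem SchwartzMap.tsum_rotation_eq_tsum_fourier (φ : 𝓢(Plane, ℂ)) (θ : ℝ) :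
    ∑' p, φ (planeRotation θ (latticePoint p)) = ∑' p, 𝓕 φ (planeRotation θ (latticePoint p)) := by
  let ψ : 𝓢(Plane, ℂ) := SchwartzMap.compCLMOfContinuousLinearEquiv ℂ
    (planeRotation θ).toContinuousLinearEquiv φ
  have hψ : ∀ v, 𝓕 ψ v = 𝓕 φ (planeRotation θ v) := fun v => by
    rw [SchwartzMap.fourier_coe, SchwartzMap.fourier_coe]
    exact Real.fourier_comp_linearIsometry (planeRotation θ) φ v
  refine ψ.tsum_plane_eq_tsum_fourier.trans (tsum_congr fun p => hψ _)

theorem SchwartzMap.integral_radialSquareMeasure (φ : 𝓢(Plane, ℂ)) :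
    ∫ x, φ x ∂radialSquareMeasure = (2 * Real.pi)⁻¹ •
      ∫ θ in (0 : ℝ)..2 * Real.pi, ∑' p, φ (planeRotation θ (latticePoint p)) := by
  have := hasTemperateGrowth_radialSquareMeasure
  have hi : Integrable φ radialSquareMeasure := φ.integrable
  rw [radialSquareMeasure_eq_sum] at hi
  rw [radialSquareMeasure_eq_sum]
  have h1 := hasSum_integral_measure hi
  simp_rw [integral_circleMeasure_norm _ φ.continuous] at h1
  obtain ⟨C, hC, hφ, -⟩ := φ.exists_norm_le_cauchyWeight
  have hs : Summable fun p => C * ((1 + ‖latticePoint p‖) ^ 8)⁻¹ :=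
    (summable_latticePoint 1).mul_left C
  have hb : ∀ p θ, ‖φ (planeRotation θ (latticePoint p))‖ ≤
      C * ((1 + ‖latticePoint p‖) ^ 8)⁻¹ := fun p θ => by
    have := hφ (planeRotation θ (latticePoint p))
    rwa [LinearIsometryEquiv.norm_map] at this
  have h2 : HasSum (fun p => ∫ θ in (0 : ℝ)..2 * Real.pi, φ (planeRotation θ (latticePoint p)))
      (∫ θ in (0 : ℝ)..2 * Real.pi, ∑' p, φ (planeRotation θ (latticePoint p))) := by
    refine intervalIntegral.hasSum_integral_of_dominated_convergence
      (fun p _ => C * ((1 + ‖latticePoint p‖) ^ 8)⁻¹) (fun p => ?_) (fun p => ?_) ?_ ?_ ?_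
    · have : Continuous fun θ => planeRotation θ (latticePoint p) := by
        simp only [planeRotation_apply]
        fun_prop
      exact (φ.continuous.comp this).aestronglyMeasurable
    · exact Filter.Eventually.of_forall fun θ _ => hb p θ
    · exact Filter.Eventually.of_forall fun θ _ => hs
    · exact intervalIntegrable_const
    · exact Filter.Eventually.of_forall fun θ _ =>
        (Summable.of_norm_bounded hs fun p => hb p θ).hasSum
  exact h1.unique (h2.const_smul _)

theorem SchwartzMap.integral_fourier_radialSquareMeasure (φ : 𝓢(Plane, ℂ)) :
    ∫ x, φ x ∂radialSquareMeasure = ∫ x, 𝓕 φ x ∂radialSquareMeasure := by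
  rw [φ.integral_radialSquareMeasure, SchwartzMap.integral_radialSquareMeasure (𝓕 φ)]
  simp_rw [φ.tsum_rotation_eq_tsum_fourier]

theorem mainTheorem2 :
    -- The Fourier transform of each `μ_r`, as a function and as a tempered distribution.
    (∀ r : ℝ, 0 ≤ r →
      (∀ k : Plane,
        ∫ x, Complex.exp (-2 * Real.pi * Complex.I * (inner ℝ k x : ℝ)) ∂(circleMeasure r) =
          (besselJZero (2 * Real.pi * ‖k‖ * r) : ℂ)) ∧
      IsGivenByFunction (𝓕 (circleMeasure r).toTemperedDistribution)
        (fun k => (besselJZero (2 * Real.pi * ‖k‖ * r) : ℂ))) ∧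
    -- The measure is tempered, it is its own Fourier transform, and the Bessel series converges
    -- to it unconditionally in the space of tempered distributions.
    ∃ _ : radialSquareMeasure.HasTemperateGrowth,
      radialSquareMeasure.toTemperedDistribution =
        𝓕 radialSquareMeasure.toTemperedDistribution ∧
      ∃ B : squareRadii → 𝓢'(Plane, ℂ),
        (∀ r : squareRadii, IsGivenByFunction (B r)
          (fun k => (besselJZero (2 * Real.pi * ‖k‖ * r) : ℂ))) ∧
        HasSum (fun r : squareRadii => (shellingNumber r : ℂ) • B r)
          (𝓕 radialSquareMeasure.toTemperedDistribution) := by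
  refine ⟨fun r _ => ⟨integral_exp_inner_circleMeasure r,
    isGivenByFunction_fourier_circleMeasure r⟩, hasTemperateGrowth_radialSquareMeasure, ?_,
    fun r => 𝓕 (circleMeasure r).toTemperedDistribution,
    fun r => isGivenByFunction_fourier_circleMeasure r, ?_⟩
  · ext φ
    exact φ.integral_fourier_radialSquareMeasure
  · have := hasTemperateGrowth_radialSquareMeasure
    refine PointwiseConvergenceCLM.tendsto_iff_forall_tendsto.2 fun φ => ?_
    have hi : Integrable (𝓕 φ : 𝓢(Plane, ℂ)) radialSquareMeasure := (𝓕 φ).integrable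
    rw [radialSquareMeasure] at hi
    have h : HasSum (fun r : squareRadii => (shellingNumber r : ℂ) •
        ∫ x, (𝓕 φ : 𝓢(Plane, ℂ)) x ∂circleMeasure r)
        (∫ x, (𝓕 φ : 𝓢(Plane, ℂ)) x ∂radialSquareMeasure) := by
      refine (hasSum_integral_measure hi).congr_fun fun r => ?_
      rw [integral_smul_measure]
      simp
    refine (h : Filter.Tendsto _ _ _).congr fun s => ?_
    rw [sum_apply]
    rfl
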